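/- Let $\alpha,\beta>0$. A random vector $X$ in $\mathbb R^n$ is called isotropic if $\mathbb E\langle X,a\rangle^2=\|a\|_2^2$ for all $a\in\mathbb R^n$; it satisfies a $\psi_2$ condition with constant $\beta$ if $\|\langle X,a\rangle\|_{\psi_2}\le\beta\|a\|_2$ for all $a\in\mathbb R^n$, where $\|Y\|_{\psi_2}=\inf\{C>0:\ \mathbb E\exp(|Y|^2/C^2)\le 2\}$ (with $\inf\emptyset=\infty$); and it has a concentration property with constant $\alpha$ if $\sup_{t\in\mathbb R}\Pr(|\langle X,a\rangle-t|<\varepsilon)\le\alpha\varepsilon$ for all $\varepsilon\ge0$ and all $a$ in the Euclidean unit sphere $S^{n-1}$. There is a constant $c(\alpha,\beta)>1$, depending only on $\alpha$ and $\beta$, such that the following holds. Let $m,n\in\mathbb N$ and let $\Gamma$ be an $m\times n$ real random matrix whose rows are independent, identically distributed, centered and isotropic random vectors in $\mathbb R^n$ which satisfy a $\psi_2$ condition with constant $\beta$ and have a concentration property with constant $\alpha$. Let $D\ge c(\alpha,\beta)$, let $1\le k\le n$ and $p\ge1$ be integers, and let $W_1,\dots,W_p$ be affine subspaces of $\mathbb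 R^n$ of dimension at most $k$. If $$m\ \ge\ 5\left(k+\frac{\ln p}{\ln D}\right),$$ then there is a (deterministic) number $L>0$ such that, with probability at least $1-2D^{-m/5}$, for every $1\le l\le p$ and all $x,y\in W_l$, $$\frac LD\,\|x-y\|_2\ \le\ \|\Gamma x-\Gamma y\|_2\ \le\ L\,\|x-y\|_2 .$$ -/

import Mathlib

open MeasureTheory ProbabilityTheory
open scoped ENNReal RealInnerProductSpace

noncomputable section

/-- The `ψ₂` norm `inf {C > 0 : 𝔼 exp (|X|² / C²) ≤ 2}` of a real random variable, with values in
`[0, ∞]`; it is `∞` when no `C` is admissible. -/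
def psiTwoNorm {Ω : Type*} [MeasurableSpace Ω] (P : Measure Ω) (X : Ω → ℝ) : ℝ≥0∞ :=
  sInf {r : ℝ≥0∞ | ∃ C : ℝ, 0 < C ∧
    ∫⁻ ω, ENNReal.ofReal (Real.exp (|X ω| ^ 2 / C ^ 2)) ∂P ≤ 2 ∧ r = ENNReal.ofReal C}

/-- The `ε`-concentration `sup_L P(|X - L| < ε)` of a real random variable. -/
def concentration {Ω : Type*} [MeasurableSpace Ω] (P : Measure Ω) (X : Ω → ℝ) (ε : ℝ) : ℝ≥0∞ :=
  ⨆ L : ℝ, P {ω | |X ω - L| < ε}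

/-- The random vector `X` is centered. -/
def IsCentered {Ω : Type*} [MeasurableSpace Ω] (P : Measure Ω) {n : ℕ}
    (X : Ω → EuclideanSpace ℝ (Fin n)) : Prop :=
  Integrable X P ∧ ∫ ω, X ω ∂P = 0

/-- The random vector `X` is isotropic: `𝔼 ⟨X, a⟩² = ‖a‖²` for all `a`. -/
def IsIsotropic {Ω : Type*} [MeasurableSpace Ω] (P : Measure Ω) {n : ℕ}
    (X : Ω → EuclideanSpace ℝ (Fin n)) : Prop :=
  ∀ a : EuclideanSpace ℝ (Fin n),
    Integrable (fun ω => ⟪X ω, a⟫ ^ 2) P ∧ ∫ ω, ⟪X ω, a⟫ ^ 2 ∂P = ‖a‖ ^ 2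

/-- The random vector `X` satisfies a `ψ₂` condition with constant `β`. -/
def PsiTwoCondition {Ω : Type*} [MeasurableSpace Ω] (P : Measure Ω) {n : ℕ}
    (X : Ω → EuclideanSpace ℝ (Fin n)) (β : ℝ) : Prop :=
  ∀ a : EuclideanSpace ℝ (Fin n),
    psiTwoNorm P (fun ω => ⟪X ω, a⟫) ≤ ENNReal.ofReal (β * ‖a‖)

/-- The random vector `X` has a concentration property with constant `α`. -/
def ConcentrationProperty {Ω : Type*} [MeasurableSpace Ω] (P : Measure Ω) {n : ℕ}
    (X : Ω → EuclideanSpace ℝ (Fin n)) (α : ℝ) : Prop :=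
  ∀ ε : ℝ, 0 ≤ ε → ∀ a : EuclideanSpace ℝ (Fin n), ‖a‖ = 1 →
    concentration P (fun ω => ⟪X ω, a⟫) ε ≤ ENNReal.ofReal (α * ε)

/-- The `i`-th row of a random matrix, as a random vector in Euclidean space. -/
def randomRow {Ω : Type*} {m n : ℕ} (Γ : Ω → Matrix (Fin m) (Fin n) ℝ) (i : Fin m) (ω : Ω) :
    EuclideanSpace ℝ (Fin n) :=
  WithLp.toLp 2 (Γ ω i)

end

/-! Differences of points of `W l` lie in its direction, so two-sided bounds for `Γ` on the unit
sphere of each direction suffice. These follow from bounds on a `1/D`-net of at most `(3D)^k` points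
(`exists_net_unitSphere`, `norm_bounds_of_net`).

For a unit vector `x`, `‖Γx‖²` is a sum of `m` independent squares, and one exponential Markov
inequality (`measure_le_mul_sum_sq_le`) handles both tails. With positive `κ`, the `ψ₂` moment makes
`‖Γx‖ > L/2` unlikely; with negative `κ`, small-ball concentration makes `‖Γx‖ < 2L/D` unlikely.
Taking `L` of order `β√(m log D)`, each failure has probability at most `r^m`, where `r` is of order
`(log D)/D`. Since `r^m` beats the number `p(3D)^k` of net points, a union bound finishes. -/

open Metric Filter

/-! ### Nets on unit spheres. -/

/-- A finite `ε`-separated set in the unit ball has at most `(3 / ε) ^ dim` elements. -/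
theorem card_le_of_separated_unitBall {E : Type*} [NormedAddCommGroup E] [NormedSpace ℝ E]
    [FiniteDimensional ℝ E] {ε : ℝ} (hε : 0 < ε) (hε1 : ε ≤ 1) (s : Finset E)
    (hs : ∀ c ∈ s, ‖c‖ ≤ 1) (h : ∀ c ∈ s, ∀ d ∈ s, c ≠ d → ε ≤ ‖c - d‖) :
    (s.card : ℝ) ≤ (3 / ε) ^ Module.finrank ℝ E := by
  borelize E
  let μ : Measure E := Measure.addHaar
  set d := Module.finrank ℝ E
  have hδ : 0 < ε / 2 := by positivity
  have hdisj : Set.Pairwise (s : Set E) (Function.onFun Disjoint fun c => ball (c : E) (ε / 2)) := by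
    rintro a ha b hb hab
    apply ball_disjoint_ball
    rw [dist_eq_norm]
    linarith [h a ha b hb hab]
  -- Here `ε ≤ 1` enters: `1 + ε/2 ≤ 3/2`, so the ratio of radii is `3/ε`.
  have hsub : (⋃ c ∈ s, ball (c : E) (ε / 2)) ⊆ ball (0 : E) (3 / 2) := by
    refine Set.iUnion₂_subset fun x hx => ball_subset_ball' ?_
    rw [dist_zero_right]
    linarith [hs x hx]
  have hmeas : (s.card : ℝ≥0∞) * ENNReal.ofReal ((ε / 2) ^ d) * μ (ball 0 1) ≤
      ENNReal.ofReal ((3 / 2) ^ d) * μ (ball 0 1) :=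
    calc
      _ = μ (⋃ c ∈ s, ball (c : E) (ε / 2)) := by
        rw [measure_biUnion_finset hdisj fun c _ => measurableSet_ball]
        simp only [μ.addHaar_ball_of_pos _ hδ, Finset.sum_const, nsmul_eq_mul, mul_assoc, d]
      _ ≤ μ (ball (0 : E) (3 / 2)) := measure_mono hsub
      _ = _ := μ.addHaar_ball_of_pos _ (by norm_num)
  have hcard : (s.card : ℝ≥0∞) * ENNReal.ofReal ((ε / 2) ^ d) ≤ ENNReal.ofReal ((3 / 2) ^ d) :=
    (ENNReal.mul_le_mul_iff_left (measure_ball_pos _ _ zero_lt_one).ne' measure_ball_lt_top.ne).1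
      hmeas
  have hreal := ENNReal.toReal_le_of_le_ofReal (by positivity) hcard
  rw [ENNReal.toReal_mul, ENNReal.toReal_natCast, ENNReal.toReal_ofReal (by positivity),
    ← le_div_iff₀ (by positivity), ← div_pow] at hreal
  rwa [div_div_div_cancel_right₀ two_ne_zero] at hreal

/-- The unit sphere of a subspace of dimension at most `k` has an `ε`-net of at most `(3 / ε) ^ k`
points. -/
theorem exists_net_unitSphere {V : Type*} [NormedAddCommGroup V] [NormedSpace ℝ V]
    [FiniteDimensional ℝ V] (E : Submodule ℝ V) {k : ℕ} (hk : Module.finrank ℝ E ≤ k)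
    {ε : ℝ} (hε : 0 < ε) (hε1 : ε ≤ 1) :
    ∃ N : Finset V, (∀ x ∈ N, ‖x‖ = 1) ∧ (N : Set V) ⊆ E ∧ (N.card : ℝ) ≤ (3 / ε) ^ k ∧
      ∀ x ∈ E, ‖x‖ = 1 → ∃ y ∈ N, ‖x - y‖ ≤ ε := by
  classical
  set K : ℕ := ⌊(3 / ε) ^ k⌋₊
  let δ : NNReal := ⟨ε, hε.le⟩
  let A : Set E := sphere 0 1
  have hδ : (δ : ℝ≥0∞) = ENNReal.ofReal ε := (ENNReal.ofReal_eq_coe_nnreal hε.le).symm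
  have hfin : ∀ s : Finset E, (s : Set E) ⊆ A → IsSeparated δ (s : Set E) → s.card ≤ K := by
    intro s hsA hs
    refine Nat.le_floor ((card_le_of_separated_unitBall hε hε1 s ?_ ?_).trans ?_)
    · intro c hc
      simpa [A] using (hsA hc).le
    · intro a ha b hb hab
      have := hs ha hb hab
      rw [hδ, edist_dist, dist_eq_norm] at this
      exact (ENNReal.ofReal_lt_ofReal_iff'.1 this).1.le
    · exact pow_le_pow_right₀ (by rw [le_div_iff₀ hε]; linarith) hk
  -- Competing separated sets may be infinite, so a subset of exactly `K + 1` points is extracted to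
  -- contradict the finite bound.
  have hpack : packingNumber δ A ≤ K := by
    refine iSup_le fun C => iSup_le fun hCA => iSup_le fun hC => ?_
    by_contra! hlt
    obtain ⟨t, htC, ht⟩ := Set.exists_subset_encard_eq (s := C) (k := (K + 1 : ℕ))
      (by exact_mod_cast Order.add_one_le_of_lt hlt)
    have htf : t.Finite := Set.finite_of_encard_eq_coe ht
    have hle := hfin htf.toFinset (by simpa using htC.trans hCA)
      (by rw [htf.coe_toFinset]; exact Set.Pairwise.mono htC hC)
    rw [htf.encard_eq_coe_toFinset_card] at ht
    have : htf.toFinset.card = K + 1 := by exact_mod_cast ht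
    omega
  have hne : packingNumber δ A ≠ ⊤ := ne_top_of_le_ne_top (ENat.natCast_ne_top K) hpack
  have hM := encard_maximalSeparatedSet hne
  have hMf : (maximalSeparatedSet δ A).Finite := by
    rw [← Set.encard_ne_top_iff, hM]
    exact hne
  have hMA : maximalSeparatedSet δ A ⊆ A := maximalSeparatedSet_subset
  refine ⟨hMf.toFinset.image E.subtype, ?_, ?_, ?_, ?_⟩
  · intro x hx
    obtain ⟨y, hy, rfl⟩ := Finset.mem_image.1 hx
    simpa [A] using hMA (hMf.mem_toFinset.1 hy)
  · intro x hx
    obtain ⟨y, hy, rfl⟩ := Finset.mem_image.1 (Finset.mem_coe.1 hx)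
    exact y.2
  · have h1 : hMf.toFinset.card ≤ K := hfin _ (by simpa using hMA)
      (by simpa using isSeparated_maximalSeparatedSet)
    calc ((hMf.toFinset.image E.subtype).card : ℝ) ≤ (hMf.toFinset.card : ℝ) := by
          exact_mod_cast Finset.card_image_le
      _ ≤ K := by exact_mod_cast h1
      _ ≤ _ := Nat.floor_le (by positivity)
  · intro x hxE hx
    obtain ⟨y, hy, hxy⟩ := isCover_maximalSeparatedSet hne (show (⟨x, hxE⟩ : E) ∈ A by simpa [A])
    refine ⟨y, Finset.mem_image.2 ⟨y, hMf.mem_toFinset.2 hy, rfl⟩, ?_⟩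
    have hxy' : edist (⟨x, hxE⟩ : E) y ≤ δ := hxy
    rw [hδ, edist_dist, ENNReal.ofReal_le_ofReal_iff hε.le, dist_eq_norm] at hxy'
    simpa using hxy'

/-- A linear map that is bounded above and below on a `1 / D`-net of the unit sphere of a subspace
is bi-Lipschitz on that subspace. -/
theorem norm_bounds_of_net {V F : Type*} [NormedAddCommGroup V] [NormedSpace ℝ V]
    [FiniteDimensional ℝ V] [NormedAddCommGroup F] [NormedSpace ℝ F] (E : Submodule ℝ V)
    (A : V →ₗ[ℝ] F) {L D : ℝ} (hL : 0 < L) (hD : 2 ≤ D) (N : Set V) (hNE : N ⊆ E)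
    (hnet : ∀ x ∈ E, ‖x‖ = 1 → ∃ y ∈ N, ‖x - y‖ ≤ 1 / D)
    (hlow : ∀ x ∈ N, 2 * L / D ≤ ‖A x‖) (hupp : ∀ x ∈ N, ‖A x‖ ≤ L / 2) :
    ∀ x ∈ E, L / D * ‖x‖ ≤ ‖A x‖ ∧ ‖A x‖ ≤ L * ‖x‖ := by
  have hD0 : 0 < D := by linarith
  let B : E →L[ℝ] F := LinearMap.toContinuousLinearMap (A.domRestrict E)
  have hB : ∀ x ∈ E, ‖A x‖ ≤ ‖B‖ * ‖x‖ := fun x hx => B.le_opNorm ⟨x, hx⟩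
  have hdiff : ∀ x ∈ E, ∀ y ∈ N, ‖x - y‖ ≤ 1 / D → ‖A x - A y‖ ≤ ‖B‖ * (1 / D) := by
    intro x hx y hy hxy
    rw [← map_sub]
    exact (hB _ (E.sub_mem hx (hNE hy))).trans (by gcongr)
  have hone : 1 / D ≤ 1 / 2 := by gcongr
  have scale : ∀ x ∈ E, x ≠ 0 → ∃ u ∈ E, ‖u‖ = 1 ∧ ‖A x‖ = ‖x‖ * ‖A u‖ := by
    intro x hx hx0
    have hn : ‖x‖ ≠ 0 := norm_ne_zero_iff.2 hx0
    refine ⟨‖x‖⁻¹ • x, E.smul_mem _ hx, ?_, ?_⟩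
    · rw [norm_smul, norm_inv, norm_norm, inv_mul_cancel₀ hn]
    · rw [map_smul, norm_smul, norm_inv, norm_norm, mul_inv_cancel_left₀ hn]
  have hBn := norm_nonneg B
  have hunit : ∀ u ∈ E, ‖u‖ = 1 → ‖A u‖ ≤ L / 2 + ‖B‖ / 2 := by
    intro u hu hu1
    obtain ⟨y, hy, hxy⟩ := hnet u hu hu1
    have h1 := hdiff u hu y hy hxy
    have h2 := norm_sub_norm_le (A u) (A y)
    have h3 := mul_le_mul_of_nonneg_left hone hBn
    linarith [hupp y hy]
  -- The norm of `B` is finite and bounded by `L/2 + ‖B‖/2`, hence by `L`.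
  have hBL : ‖B‖ ≤ L := by
    have : ‖B‖ ≤ L / 2 + ‖B‖ / 2 := by
      refine B.opNorm_le_bound (by positivity) ?_
      rintro ⟨x, hx⟩
      change ‖A x‖ ≤ _ * ‖x‖
      rcases eq_or_ne x 0 with rfl | hx0
      · simp
      · obtain ⟨u, hu, hu1, hux⟩ := scale x hx hx0
        rw [hux, mul_comm]
        gcongr
        exact hunit u hu hu1
    linarith
  intro x hx
  refine ⟨?_, (hB x hx).trans (by gcongr)⟩
  rcases eq_or_ne x 0 with rfl | hx0
  · simp
  · obtain ⟨u, hu, hu1, hux⟩ := scale x hx hx0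
    rw [hux, mul_comm]
    gcongr
    obtain ⟨y, hy, hxy⟩ := hnet u hu hu1
    have h1 := hdiff u hu y hy hxy
    have h2 := norm_sub_norm_le (A y) (A u)
    rw [norm_sub_rev] at h2
    have h3 : ‖B‖ * (1 / D) ≤ L / D := by
      rw [mul_one_div]
      gcongr
    have h4 := hlow y hy
    have h5 : 2 * L / D = L / D + L / D := by ring
    linarith

/-! ### Exponential moments and tails of the marginals. -/

/-- Chernoff bound for a multiple of a sum of squares of independent random variables. -/
theorem measure_le_mul_sum_sq_le {Ω : Type*} [MeasurableSpace Ω] {P : Measure Ω} {m : ℕ}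
    {Y : Fin m → Ω → ℝ} (hY : ∀ i, Measurable (Y i)) (hind : iIndepFun Y P) (κ u : ℝ) {B : ℝ}
    (hB : ∀ i, ∫⁻ ω, ENNReal.ofReal (Real.exp (κ * Y i ω ^ 2)) ∂P ≤ ENNReal.ofReal B) :
    P {ω | u * m ≤ κ * ∑ i, Y i ω ^ 2} ≤ ENNReal.ofReal (Real.exp (-u) * B) ^ m := by
  let g : ℝ → ℝ≥0∞ := fun y => ENNReal.ofReal (Real.exp (κ * y ^ 2))
  have hg : Measurable g := by fun_prop
  have hprod : ∀ ω, ∏ i, g (Y i ω) = ENNReal.ofReal (Real.exp (κ * ∑ i, Y i ω ^ 2)) := by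
    intro ω
    rw [Finset.mul_sum, Real.exp_sum, ENNReal.ofReal_prod_of_nonneg fun i _ => (Real.exp_pos _).le]
  have hint : ∫⁻ ω, ∏ i, g (Y i ω) ∂P ≤ ENNReal.ofReal B ^ m := by
    rw [lintegral_prod_eq_prod_lintegral_of_indepFun Finset.univ (fun i ω => g (Y i ω))
      (hind.comp (fun _ => g) fun _ => hg) fun i => hg.comp (hY i)]
    exact (Finset.prod_le_prod' fun i _ => hB i).trans (by simp)
  have hset : {ω | u * m ≤ κ * ∑ i, Y i ω ^ 2} =
      {ω | ENNReal.ofReal (Real.exp (u * m)) ≤ ∏ i, g (Y i ω)} := by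
    ext ω
    simp only [Set.mem_ofPred_eq]
    rw [hprod, ENNReal.ofReal_le_ofReal_iff (Real.exp_pos _).le, Real.exp_le_exp]
  have hmarkov := (mul_meas_ge_le_lintegral (μ := P)
    (Finset.measurable_prod Finset.univ fun i _ => hg.comp (hY i))
    (ENNReal.ofReal (Real.exp (u * m)))).trans hint
  rw [hset, ENNReal.ofReal_mul (Real.exp_pos _).le, mul_pow, ← ENNReal.ofReal_pow (Real.exp_pos _).le,
    ← Real.exp_nat_mul]
  calc P {ω | ENNReal.ofReal (Real.exp (u * m)) ≤ ∏ i, g (Y i ω)}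
      = ENNReal.ofReal (Real.exp (m * -u)) * (ENNReal.ofReal (Real.exp (u * m)) *
        P {ω | ENNReal.ofReal (Real.exp (u * m)) ≤ ∏ i, g (Y i ω)}) := by
        rw [← mul_assoc, ← ENNReal.ofReal_mul (Real.exp_pos _).le, ← Real.exp_add]
        have : (m : ℝ) * -u + u * m = 0 := by ring
        rw [this, Real.exp_zero, ENNReal.ofReal_one, one_mul]
    _ ≤ _ := by gcongr; exact hmarkov

/-- A bound on the `ψ₂` norm bounds a square-exponential moment. -/
theorem lintegral_exp_sq_le_two {Ω : Type*} [MeasurableSpace Ω] {P : Measure Ω} {X : Ω → ℝ} {β : ℝ}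
    (hβ : 0 < β) (hX : psiTwoNorm P X ≤ ENNReal.ofReal β) :
    ∫⁻ ω, ENNReal.ofReal (Real.exp (1 / (2 * β) ^ 2 * X ω ^ 2)) ∂P ≤ 2 := by
  -- The infimum need not be attained; doubling `β` leaves room for an admissible `C`.
  have hlt : psiTwoNorm P X < ENNReal.ofReal (2 * β) :=
    hX.trans_lt ((ENNReal.ofReal_lt_ofReal_iff (by positivity)).2 (by linarith))
  obtain ⟨r, ⟨C, hC, hint, rfl⟩, hr⟩ := sInf_lt_iff.1 hlt
  have hCβ : C < 2 * β := (ENNReal.ofReal_lt_ofReal_iff (by positivity)).1 hr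
  refine (lintegral_mono fun ω => ENNReal.ofReal_le_ofReal (Real.exp_le_exp.2 ?_)).trans hint
  rw [sq_abs, one_div_mul_eq_div]
  gcongr

/-- The concentration function bounds the Laplace transform of the square. -/
theorem lintegral_exp_neg_sq_le {Ω : Type*} [MeasurableSpace Ω] {P : Measure Ω}
    [IsProbabilityMeasure P] {X : Ω → ℝ} (hXm : Measurable X) {s t b : ℝ} (hs : 0 < s) (ht : 0 ≤ t)
    (hb : 0 ≤ b) (hX : concentration P X (s * t) ≤ ENNReal.ofReal b) :
    ∫⁻ ω, ENNReal.ofReal (Real.exp (-(1 / s ^ 2) * X ω ^ 2)) ∂P ≤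
      ENNReal.ofReal (b + Real.exp (-t ^ 2)) := by
  have hS : MeasurableSet {ω | |X ω| < s * t} := measurableSet_lt (by fun_prop) (by fun_prop)
  calc ∫⁻ ω, ENNReal.ofReal (Real.exp (-(1 / s ^ 2) * X ω ^ 2)) ∂P
      ≤ ∫⁻ ω, ({ω | |X ω| < s * t}.indicator 1 ω + ENNReal.ofReal (Real.exp (-t ^ 2))) ∂P := by
        refine lintegral_mono fun ω => ?_
        by_cases h : |X ω| < s * t
        · rw [Set.indicator_of_mem (by exact h)]
          refine le_add_right (ENNReal.ofReal_le_one.2 (Real.exp_le_one_iff.2 ?_))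
          have : 0 ≤ 1 / s ^ 2 * X ω ^ 2 := by positivity
          linarith
        · refine le_add_left (ENNReal.ofReal_le_ofReal (Real.exp_le_exp.2 ?_))
          have h1 : (s * t) ^ 2 ≤ X ω ^ 2 := by
            rw [← sq_abs (X ω)]
            gcongr
            exact not_lt.1 h
          rw [neg_mul, neg_le_neg_iff, one_div_mul_eq_div, le_div_iff₀ (by positivity)]
          linarith [mul_pow s t 2]
    _ = P {ω | |X ω| < s * t} + ENNReal.ofReal (Real.exp (-t ^ 2)) := by
        rw [lintegral_add_right _ measurable_const, lintegral_indicator_one hS]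
        simp
    _ ≤ ENNReal.ofReal b + ENNReal.ofReal (Real.exp (-t ^ 2)) := by
        gcongr
        refine le_trans (le_of_eq ?_)
          ((le_iSup (fun L : ℝ => P {ω | |X ω - L| < s * t}) 0).trans hX)
        simp only [sub_zero]
    _ = _ := (ENNReal.ofReal_add hb (Real.exp_pos _).le).symm

/-- The squared norm of `Γ x` is the sum of the squared inner products of `x` with the rows. -/
theorem norm_sq_toEuclideanLin {Ω : Type*} {m n : ℕ} (Γ : Ω → Matrix (Fin m) (Fin n) ℝ) (ω : Ω)
    (x : EuclideanSpace ℝ (Fin n)) :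
    ‖Matrix.toEuclideanLin (Γ ω) x‖ ^ 2 = ∑ i, ⟪randomRow Γ i ω, x⟫ ^ 2 := by
  rw [EuclideanSpace.norm_sq_eq]
  refine Finset.sum_congr rfl fun i _ => ?_
  rw [Real.norm_eq_abs, sq_abs, Matrix.toEuclideanLin, Matrix.toLpLin_apply, randomRow,
    EuclideanSpace.inner_eq_star_dotProduct]
  simp [Matrix.mulVec, dotProduct_comm]

/-! ### Choice of constants. -/

/-- The cardinality of `p` nets of size `(3 D) ^ k` is absorbed by an `m`-th power when
`m ≥ 5 (k + ln p / ln D)`. -/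
theorem net_card_mul_pow_le {D r : ℝ} {k p m : ℕ} (hD : 1 < D) (hr : 0 ≤ r)
    (hrD : 3 * r ≤ D ^ (-(2 / 5 : ℝ))) (hp : 1 ≤ p)
    (hm : 5 * ((k : ℝ) + Real.log p / Real.log D) ≤ (m : ℝ)) :
    p * (3 * D) ^ k * r ^ m ≤ D ^ (-(m : ℝ) / 5) := by
  have hD0 : 0 < D := by linarith
  have hlog : 0 < Real.log D := Real.log_pos hD
  have hp0 : (0 : ℝ) < p := by exact_mod_cast hp
  have hlp : 0 ≤ Real.log p / Real.log D :=
    div_nonneg (Real.log_nonneg (by exact_mod_cast hp)) hlog.le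
  have hkm : k ≤ m := by
    have : (k : ℝ) ≤ m := by linarith [Nat.cast_nonneg (α := ℝ) k]
    exact_mod_cast this
  have hpD : (p : ℝ) = D ^ (Real.log p / Real.log D) := by
    rw [Real.rpow_def_of_pos hD0, mul_div_cancel₀ _ hlog.ne', Real.exp_log hp0]
  have h1 : p * D ^ k ≤ D ^ ((m : ℝ) / 5) := by
    rw [hpD, ← Real.rpow_natCast D k, ← Real.rpow_add hD0]
    exact Real.rpow_le_rpow_of_exponent_le hD.le (by linarith)
  -- As `k ≤ m`, the factor `3 ^ k` is absorbed into `(3r)^m`; the exponents add up to `m/5 - 2m/5`.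
  calc p * (3 * D) ^ k * r ^ m = (p * D ^ k) * 3 ^ k * r ^ m := by ring
    _ ≤ D ^ ((m : ℝ) / 5) * 3 ^ m * r ^ m := by
        gcongr
        norm_num
    _ = D ^ ((m : ℝ) / 5) * (3 * r) ^ m := by ring
    _ ≤ D ^ ((m : ℝ) / 5) * (D ^ (-(2 / 5 : ℝ))) ^ m := by gcongr
    _ = D ^ (-(m : ℝ) / 5) := by
        rw [← Real.rpow_mul_natCast hD0.le, ← Real.rpow_add hD0]
        congr 1
        ring

/-- An affine function of `log D` is eventually dominated by `D ^ (3 / 5)`. -/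
theorem exists_threshold (a b : ℝ) :
    ∃ c : ℝ, 2 ≤ c ∧ ∀ D, c ≤ D → a * Real.log D + b ≤ D ^ (3 / 5 : ℝ) := by
  have h1 : (fun D : ℝ => a * Real.log D + b) =o[atTop] fun D : ℝ => D ^ (3 / 5 : ℝ) := by
    refine ((isLittleO_log_rpow_atTop (by norm_num)).const_mul_left a).add ?_
    refine Asymptotics.isLittleO_const_left.2 (Or.inr ?_)
    exact tendsto_norm_atTop_atTop.comp (tendsto_rpow_atTop (by norm_num))
  obtain ⟨c, hc⟩ := eventually_atTop.1 (h1.bound one_pos)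
  refine ⟨max c 2, le_max_right _ _, fun D hD => ?_⟩
  have h2 := hc D ((le_max_left _ _).trans hD)
  have hD0 : 0 ≤ D := by linarith [(le_max_right c 2).trans hD]
  rw [one_mul, Real.norm_eq_abs, Real.norm_eq_abs, abs_of_nonneg (Real.rpow_nonneg hD0 _)] at h2
  exact (le_abs_self _).trans h2

/-! ### The bi-Lipschitz estimate. -/

theorem theorem3p4 (α β : ℝ) (hα : 0 < α) (hβ : 0 < β) :
    ∃ c : ℝ, 1 < c ∧
      ∀ (m n : ℕ) (Ω : Type*) [MeasurableSpace Ω] (P : Measure Ω) [IsProbabilityMeasure P]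
        (Γ : Ω → Matrix (Fin m) (Fin n) ℝ),
        (∀ i, Measurable (randomRow Γ i)) →
        iIndepFun (fun i => randomRow Γ i) P →
        (∀ i j, IdentDistrib (randomRow Γ i) (randomRow Γ j) P P) →
        (∀ i, IsCentered P (randomRow Γ i)) →
        (∀ i, IsIsotropic P (randomRow Γ i)) →
        (∀ i, PsiTwoCondition P (randomRow Γ i) β) →
        (∀ i, ConcentrationProperty P (randomRow Γ i) α) →
        ∀ (D : ℝ) (k p : ℕ) (W : Fin p → AffineSubspace ℝ (EuclideanSpace ℝ (Fin n))),
          c ≤ D → 1 ≤ k → k ≤ n → 1 ≤ p →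
          (∀ l, Module.finrank ℝ (W l).direction ≤ k) →
          5 * ((k : ℝ) + Real.log p / Real.log D) ≤ (m : ℝ) →
          ∃ L : ℝ, 0 < L ∧
            1 - 2 * D ^ (-(m : ℝ) / 5) ≤
              P.real {ω | ∀ l, ∀ x ∈ W l, ∀ y ∈ W l,
                L / D * ‖x - y‖ ≤
                    ‖Matrix.toEuclideanLin (Γ ω) x - Matrix.toEuclideanLin (Γ ω) y‖ ∧
                ‖Matrix.toEuclideanLin (Γ ω) x - Matrix.toEuclideanLin (Γ ω) y‖ ≤
                    L * ‖x - y‖} := by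
  classical
  -- This threshold is `3r ≤ D ^ (-2/5)` multiplied by `D`, with `r` as below.
  obtain ⟨c, hc2, hc⟩ := exists_threshold (3 * (Real.exp 1 * (8 * α * β))) (3 * Real.exp 1)
  refine ⟨c, by linarith, ?_⟩
  intro m n Ω _ P _ Γ hmeas hind _ _ _ hpsi hconc D k p W hcD hk _ hp hW hm
  have hD2 : 2 ≤ D := hc2.trans hcD
  have hD0 : 0 < D := by linarith
  have hlog : 0 < Real.log D := Real.log_pos (by linarith)
  have hlp : 0 ≤ Real.log p / Real.log D :=
    div_nonneg (Real.log_nonneg (by exact_mod_cast hp)) hlog.le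
  have hm0 : (0 : ℝ) < m := by
    have : (1 : ℝ) ≤ k := by exact_mod_cast hk
    linarith
  set T : ℝ := 2 * β * √(Real.log D) with hT
  set L : ℝ := 2 * (T * √m) with hL
  set r : ℝ := Real.exp 1 * (8 * α * β * Real.log D + 1) / D with hr
  have hsq : √(Real.log D) ^ 2 = Real.log D := Real.sq_sqrt hlog.le
  have hsqm : √(m : ℝ) ^ 2 = m := Real.sq_sqrt hm0.le
  have hT0 : 0 < T := by positivity
  have hL0 : 0 < L := by positivity
  have hr0 : 0 ≤ r := by positivity
  have hrD : 3 * r ≤ D ^ (-(2 / 5 : ℝ)) := by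
    have h1 := hc D hcD
    have h2 : D ^ (-(2 / 5 : ℝ)) = D ^ (3 / 5 : ℝ) / D := by
      rw [← Real.rpow_sub_one hD0.ne']
      norm_num
    rw [h2, hr, ← mul_div_assoc]
    gcongr
    linarith
  have hbound := net_card_mul_pow_le (by linarith) hr0 hrD hp hm
  -- moments of the marginals
  have hYm : ∀ (x : EuclideanSpace ℝ (Fin n)) i, Measurable fun ω => ⟪randomRow Γ i ω, x⟫ :=
    fun x i => (hmeas i).inner_const
  have hYind : ∀ x : EuclideanSpace ℝ (Fin n), iIndepFun (fun i ω => ⟪randomRow Γ i ω, x⟫) P :=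
    fun x => hind.comp (fun _ v => ⟪v, x⟫) fun _ => measurable_id.inner_const
  have hupp : ∀ x : EuclideanSpace ℝ (Fin n), ‖x‖ = 1 →
      P {ω | L / 2 < ‖Matrix.toEuclideanLin (Γ ω) x‖} ≤ ENNReal.ofReal (r ^ m) := by
    intro x hx
    have h1 := measure_le_mul_sum_sq_le (hYm x) (hYind x) (1 / (2 * β) ^ 2) (Real.log D) (B := 2)
      (fun i => by
        have := hpsi i x
        rw [hx, mul_one] at this
        simpa using lintegral_exp_sq_le_two hβ this)
    rw [ENNReal.ofReal_pow hr0]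
    refine (measure_mono ?_).trans (h1.trans ?_)
    · intro ω hω
      have h2 : L / 2 < ‖Matrix.toEuclideanLin (Γ ω) x‖ := hω
      have h3 : (L / 2) ^ 2 ≤ ‖Matrix.toEuclideanLin (Γ ω) x‖ ^ 2 := by gcongr
      simp only [Set.mem_ofPred_eq]
      rw [← norm_sq_toEuclideanLin, one_div_mul_eq_div, le_div_iff₀ (by positivity)]
      refine le_trans (le_of_eq ?_) h3
      rw [hL, mul_div_cancel_left₀ _ two_ne_zero, hT, mul_pow _ √(m : ℝ), mul_pow _ √(Real.log D), hsq,
        hsqm]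
      ring
    · gcongr
      rw [Real.exp_neg, Real.exp_log hD0, hr, inv_mul_eq_div]
      gcongr
      have h4 := Real.add_one_le_exp 1
      have h5 : 0 ≤ 8 * α * β * Real.log D := by positivity
      nlinarith [Real.exp_pos 1]
  have hlow : ∀ x : EuclideanSpace ℝ (Fin n), ‖x‖ = 1 →
      P {ω | ‖Matrix.toEuclideanLin (Γ ω) x‖ < 2 * L / D} ≤ ENNReal.ofReal (r ^ m) := by
    intro x hx
    set s : ℝ := 4 * T / D with hs
    have hs0 : 0 < s := by positivity
    -- The scale `s` makes `2L/D = s√m`; the cutoff `t = √(log D)` makes `exp(-t²) = 1/D`; `u = -1`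
    -- produces the factor `e` in `r`.
    have h1 := measure_le_mul_sum_sq_le (hYm x) (hYind x) (-(1 / s ^ 2)) (-1)
      (B := α * (s * √(Real.log D)) + Real.exp (-√(Real.log D) ^ 2))
      (fun i => lintegral_exp_neg_sq_le (hYm x i) hs0 (Real.sqrt_nonneg _) (by positivity)
        (hconc i _ (by positivity) x hx))
    rw [ENNReal.ofReal_pow hr0]
    refine (measure_mono ?_).trans (h1.trans (le_of_eq ?_))
    · intro ω hω
      have h2 : ‖Matrix.toEuclideanLin (Γ ω) x‖ < 2 * L / D := hω
      have h3 : ‖Matrix.toEuclideanLin (Γ ω) x‖ ^ 2 ≤ (2 * L / D) ^ 2 := by gcongr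
      simp only [Set.mem_ofPred_eq]
      rw [← norm_sq_toEuclideanLin, neg_mul, neg_mul, neg_le_neg_iff, one_mul,
        one_div_mul_eq_div, div_le_iff₀ (by positivity)]
      refine h3.trans (le_of_eq ?_)
      have h4 : 2 * L / D = s * √m := by rw [hs, hL]; ring
      rw [h4, mul_pow, hsqm, mul_comm]
    · congr 2
      rw [neg_neg, hsq, Real.exp_neg, Real.exp_log hD0, hr, hs, hT, mul_div_assoc (Real.exp 1)]
      congr 1
      calc α * (4 * (2 * β * √(Real.log D)) / D * √(Real.log D)) + D⁻¹
          = (8 * α * β * √(Real.log D) ^ 2 + 1) / D := by ring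
        _ = _ := by rw [hsq]
  -- nets and the union bound
  choose N hN1 hNE hNcard hNnet using fun l =>
    exists_net_unitSphere (W l).direction (hW l) (ε := 1 / D) (by positivity)
      ((div_le_one hD0).2 (by linarith))
  set S : Finset (EuclideanSpace ℝ (Fin n)) := Finset.univ.biUnion N
  have hScard : (S.card : ℝ) ≤ p * (3 * D) ^ k := by
    calc (S.card : ℝ) ≤ ∑ l, ((N l).card : ℝ) := by exact_mod_cast Finset.card_biUnion_le
      _ ≤ ∑ _l : Fin p, (3 * D) ^ k := by
          refine Finset.sum_le_sum fun l _ => (hNcard l).trans_eq ?_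
          rw [div_div_eq_mul_div, div_one]
      _ = _ := by simp
  have hS1 : ∀ x ∈ S, ‖x‖ = 1 := by
    intro x hx
    obtain ⟨l, -, hl⟩ := Finset.mem_biUnion.1 hx
    exact hN1 l x hl
  refine ⟨L, hL0, ?_⟩
  set G : Set Ω := {ω | ∀ l, ∀ x ∈ W l, ∀ y ∈ W l,
    L / D * ‖x - y‖ ≤ ‖Matrix.toEuclideanLin (Γ ω) x - Matrix.toEuclideanLin (Γ ω) y‖ ∧
    ‖Matrix.toEuclideanLin (Γ ω) x - Matrix.toEuclideanLin (Γ ω) y‖ ≤ L * ‖x - y‖} with hG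
  have hsub : Gᶜ ⊆ ⋃ x ∈ S, ({ω | L / 2 < ‖Matrix.toEuclideanLin (Γ ω) x‖} ∪
      {ω | ‖Matrix.toEuclideanLin (Γ ω) x‖ < 2 * L / D}) := by
    rw [Set.compl_subset_comm]
    intro ω hω l x hx y hy
    have hgood : ∀ z ∈ S, ‖Matrix.toEuclideanLin (Γ ω) z‖ ≤ L / 2 ∧
        2 * L / D ≤ ‖Matrix.toEuclideanLin (Γ ω) z‖ := by
      intro z hz
      by_contra hcon
      refine hω (Set.mem_biUnion hz ?_)
      rw [not_and_or, not_le, not_le] at hcon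
      exact hcon
    have hlS : ∀ z ∈ N l, z ∈ S := fun z hz => Finset.mem_biUnion.2 ⟨l, Finset.mem_univ _, hz⟩
    rw [← map_sub]
    exact norm_bounds_of_net (W l).direction (Matrix.toEuclideanLin (Γ ω)) hL0 hD2 (N l) (hNE l)
      (hNnet l) (fun z hz => (hgood z (hlS z hz)).2) (fun z hz => (hgood z (hlS z hz)).1)
      (x - y) (AffineSubspace.vsub_mem_direction hx hy)
  have hcompl : P Gᶜ ≤ ENNReal.ofReal (2 * D ^ (-(m : ℝ) / 5)) := by
    calc P Gᶜ ≤ ∑ x ∈ S, P ({ω | L / 2 < ‖Matrix.toEuclideanLin (Γ ω) x‖} ∪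
          {ω | ‖Matrix.toEuclideanLin (Γ ω) x‖ < 2 * L / D}) :=
          (measure_mono hsub).trans (measure_biUnion_finset_le _ _)
      _ ≤ ∑ _x ∈ S, (ENNReal.ofReal (r ^ m) + ENNReal.ofReal (r ^ m)) :=
          Finset.sum_le_sum fun x hx => (measure_union_le _ _).trans
            (add_le_add (hupp x (hS1 x hx)) (hlow x (hS1 x hx)))
      _ = ENNReal.ofReal (S.card * (2 * r ^ m)) := by
          rw [Finset.sum_const, nsmul_eq_mul, ← ENNReal.ofReal_add (by positivity) (by positivity),
            ENNReal.ofReal_mul (by positivity), ENNReal.ofReal_natCast, two_mul]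
      _ ≤ _ := by
          refine ENNReal.ofReal_le_ofReal ?_
          have : S.card * r ^ m ≤ p * (3 * D) ^ k * r ^ m := by gcongr
          linarith
  have hreal : P.real Gᶜ ≤ 2 * D ^ (-(m : ℝ) / 5) :=
    ENNReal.toReal_le_of_le_ofReal (by positivity) hcompl
  -- Subadditivity avoids proving that `G` is measurable.
  have hone : 1 ≤ P.real G + P.real Gᶜ := by
    simpa using measureReal_union_le (μ := P) G Gᶜ
  linarith
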